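/- **Setting.** Let $\mathbb R_+=[0,\infty)$, $N\ge1$ and $n_1,\dots,n_N,m\in\mathbb N=\{0,1,2,\dots\}$, $X=\mathbb R^{n_1}\times\dots\times\mathbb R^{n_N}$. Fix arbitrary norms $\|\cdot\|$ on $X$ and on $\mathbb R^m$, and put $\|x_i\|:=\|(0,\dots,0,x_i,0,\dots,0)\|$ for $x_i\in\mathbb R^{n_i}$. A function $\alpha:\mathbb R_+\to\mathbb R_+$ is of class $\mathcal K$ if it is continuous and strictly increasing with $\alpha(0)=0$, of class $\mathcal K_\infty$ if moreover it is unbounded. A function $\beta:\mathbb R_+\times\mathbb R_+\to\mathbb R_+$ is of class $\mathcal{KL}$ if $\beta(\cdot,t)\in\mathcal K$ for every $t\ge0$ and $\beta(s,\cdot)$ is continuous, strictly decreasing and tends to $0$ for every $s>0$. A continuous $\eta:\mathbb R_+\to\mathbb R_+$ is positive definite if $\eta(0)=0$ and $\eta(s)>0$ for $s>0$. A function $W$ from a normed space to $\mathbb R_+$ is proper and positive definite if $\alpha_1(\|\xi\|)\le W(\xi)\le\alpha_2(\|\xi\|)$ for all $\xi$, with some $\alpha_1,\alpha_2\in\mathcal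 K_\infty$. Consider subsystems $x_i(k+1)=g_i(x_1(k),\dots,x_N(k),u(k))$, $k\in\mathbb N$, with $g_i:X\times\mathbb R^m\to\mathbb R^{n_i}$, and the overall system $x(k+1)=G(x(k),u(k))$, $G=(g_1,\dots,g_N)$, with solution $x(k,\xi,u)$, $x(0,\xi,u)=\xi$. Suppose that there are $\omega_1,\omega_2\in\mathcal K$ with $\|G(\xi,\mu)\|\le\omega_1(\|\xi\|)+\omega_2(\|\mu\|)$ for all $\xi,\mu$ (continuity of $G$ is not assumed). Inputs $u:\mathbb N\to\mathbb R^m$ are bounded, and $\|u\|_\infty:=\sup_k\|u(k)\|$. The system is *ISS* if there are $\beta\in\mathcal{KL}$, $\gamma\in\mathcal K$ with $\|x(k,\xi,u)\|\le\beta(\|\xi\|,k)+\gamma(\|u\|_\infty)$ for all $\xi$, all bounded $u$ and all $k\in\mathbb N$. A proper and positive definite $V:X\to\mathbb R_+$ is a *dissipative finite-step ISS Lyapunov function* if there are an integer $M'\ge1$, $\sigma\in\mathcal K$ and a positive definite $\rho$ with $\mathrm{id}-\rho\in\mathcal K_\infty$ such that $V(x(M',\xi,u))\le\rho(V(\xi))+\sigma(\|u\|_\infty)$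 for all $\xi$ and all bounded $u$. For a map $T:\mathbb R_+^N\to\mathbb R_+^N$ write $T\not\ge\mathrm{id}$ if for every $s\in\mathbb R_+^N\setminus\{0\}$ there is an $i$ with $T(s)_i<s_i$. An *$\Omega$-path* for $T$ is a $\tilde\sigma=(\tilde\sigma_1,\dots,\tilde\sigma_N)\in\mathcal K_\infty^N$ such that each $\tilde\sigma_i^{-1}$ is locally Lipschitz on $(0,\infty)$; for every compact $K\subset(0,\infty)$ there are $0<c<C$ with $c\le(\tilde\sigma_i^{-1})'(r)\le C$ for all $i$ and all points $r\in K$ of differentiability of $\tilde\sigma_i^{-1}$; and $T(\tilde\sigma(r))_i<\tilde\sigma_i(r)$ for all $i$ and all $r>0$. **Theorem.** Suppose there are an integer $M\ge1$, functions $\mathcal V_i:\mathbb R^{n_i}\to\mathbb R_+$, $\gamma_{ij}\in\mathcal K_\infty\cup\{0\}$, $\gamma_{iu}\in\mathcal K\cup\{0\}$ and positive definite $\delta_i$ with $d_i:=\mathrm{id}+\delta_i\in\mathcal K_\infty$ ($i,j=1,\dots,N$) such that, with $\Gamma_\oplus(s)_i:=\max_j\gamma_{ij}(s_j)$ and $D:=\mathrm{diag}(d_1,\dots,d_N)$: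 1. each $\mathcal V_i$ is proper and positive definite; 2. for all $\xi=(\xi_1,\dots,\xi_N)\in X$, all bounded inputs $u$ and all $i$, $$\mathcal V_i(x_i(M,\xi,u))\le\max\Big\{\max_j\gamma_{ij}(\mathcal V_j(\xi_j)),\ \gamma_{iu}(\|u\|_\infty)\Big\};$$ 3. $\Gamma_\oplus\circ D\not\ge\mathrm{id}$. Then there exists an $\Omega$-path for $\Gamma_\oplus\circ D$. Moreover, if $\tilde\sigma$ is any $\Omega$-path for $\Gamma_\oplus\circ D$ such that for each $i$ there is an $\hat\alpha_i\in\mathcal K_\infty$ with $\tilde\sigma_i^{-1}\circ d_i^{-1}\circ\tilde\sigma_i=\mathrm{id}-\hat\alpha_i$, then $$V(\xi):=\max_i\,(\tilde\sigma_i^{-1}\circ d_i^{-1})(\mathcal V_i(\xi_i))$$ is a dissipative finite-step ISS Lyapunov function for the overall system, and the overall system is ISS. (No stability of the individual subsystems is assumed.) -/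

import Mathlib

open Filter Topology
open scoped NNReal

namespace SmallGain

/-! ### Comparison functions on `ℝ₊ = ℝ≥0` -/

/-- Class `𝒦`: continuous, strictly increasing, zero at zero. -/
def ClassK (α : ℝ≥0 → ℝ≥0) : Prop :=
  Continuous α ∧ StrictMono α ∧ α 0 = 0

/-- Class `𝒦_∞`: an unbounded function of class `𝒦`. -/
def ClassKInf (α : ℝ≥0 → ℝ≥0) : Prop :=
  ClassK α ∧ Tendsto α atTop atTop

/-- Class `ℒ`: continuous, strictly decreasing, tending to zero. -/
def ClassL (α : ℝ≥0 → ℝ≥0) : Prop :=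
  Continuous α ∧ StrictAnti α ∧ Tendsto α atTop (𝓝 0)

/-- Class `𝒦ℒ`: of class `𝒦` in the first argument, and of class `ℒ` in the second argument
for every positive value of the first. -/
def ClassKL (β : ℝ≥0 → ℝ≥0 → ℝ≥0) : Prop :=
  (∀ t, ClassK fun s => β s t) ∧ ∀ s, 0 < s → ClassL (β s)

/-- Positive definite functions `ℝ₊ → ℝ₊` (continuous by convention). -/
def PosDefFun (η : ℝ≥0 → ℝ≥0) : Prop :=
  Continuous η ∧ η 0 = 0 ∧ ∀ s, 0 < s → 0 < η s

/-- A function of class `𝒦_∞` is a bijection of `ℝ₊`, so that `Function.invFun α` is its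
two-sided inverse `α⁻¹`. -/
theorem ClassKInf.bijective {α : ℝ≥0 → ℝ≥0} (h : ClassKInf α) : Function.Bijective α := by
  refine ⟨h.1.2.1.injective, fun y => ?_⟩
  obtain ⟨b, hb⟩ := (h.2.eventually_ge_atTop y).exists
  have hy : y ∈ Set.Icc (α 0) (α b) := ⟨by rw [h.1.2.2]; exact zero_le, hb⟩
  obtain ⟨x, -, hx⟩ := intermediate_value_Icc (zero_le : (0 : ℝ≥0) ≤ b) h.1.1.continuousOn hy
  exact ⟨x, hx⟩

/-! ### Norms on real vector spaces -/

/-- A norm on a real vector space, as an explicit object. -/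
structure VectorNorm (E : Type*) [AddCommGroup E] [Module ℝ E] extends Seminorm ℝ E where
  eq_zero_of_map_eq_zero : ∀ x, toFun x = 0 → x = 0

/-- The value `‖x‖ ∈ ℝ₊`. -/
def VectorNorm.val {E : Type*} [AddCommGroup E] [Module ℝ E] (p : VectorNorm E) (x : E) : ℝ≥0 :=
  ⟨p.toSeminorm x, apply_nonneg p.toSeminorm x⟩

/-- The norm `‖x_i‖ := ‖(0, …, 0, x_i, 0, …, 0)‖` on the `i`-th factor. -/
def VectorNorm.component {N : ℕ} {n : Fin N → ℕ}
    (p : VectorNorm (∀ i, Fin (n i) → ℝ)) (i : Fin N) : VectorNorm (Fin (n i) → ℝ) where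
  toSeminorm := p.toSeminorm.comp (LinearMap.single ℝ (fun i => Fin (n i) → ℝ) i)
  eq_zero_of_map_eq_zero := fun x hx =>
    (Pi.single_eq_zero_iff (i := i)).1 (p.eq_zero_of_map_eq_zero (Pi.single i x) hx)

/-- `‖u‖_∞ < ∞`. -/
def BoundedInput {U : Type*} [AddCommGroup U] [Module ℝ U] (q : VectorNorm U) (u : ℕ → U) : Prop :=
  BddAbove (Set.range fun k => q.val (u k))

/-- `‖u‖_∞ = sup_k ‖u(k)‖`; used for bounded `u` only. -/
noncomputable def supNorm {U : Type*} [AddCommGroup U] [Module ℝ U]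
    (q : VectorNorm U) (u : ℕ → U) : ℝ≥0 :=
  ⨆ k, q.val (u k)

/-! ### Discrete-time systems `x(k+1) = G(x(k), u(k))` -/

/-- The solution `x(k, ξ, u)`. -/
def solution {X U : Type*} (G : X → U → X) (ξ : X) (u : ℕ → U) : ℕ → X
  | 0 => ξ
  | k + 1 => G (solution G ξ u k) (u k)

/-- The overall system `G = (g_1, …, g_N)` of interconnected subsystems
`x_i(k+1) = g_i(x_1(k), …, x_N(k), u(k))`. -/
def overall {N m : ℕ} {n : Fin N → ℕ}
    (g : ∀ i, (∀ j, Fin (n j) → ℝ) → (Fin m → ℝ) → (Fin (n i) → ℝ)) :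
    (∀ j, Fin (n j) → ℝ) → (Fin m → ℝ) → (∀ j, Fin (n j) → ℝ) :=
  fun x μ i => g i x μ

section Systems

variable {X U : Type*} [AddCommGroup X] [Module ℝ X] [AddCommGroup U] [Module ℝ U]

/-- Global `𝒦`-boundedness of the right-hand side. -/
def GloballyKBounded (p : VectorNorm X) (q : VectorNorm U) (G : X → U → X) : Prop :=
  ∃ ω₁ ω₂ : ℝ≥0 → ℝ≥0, ClassK ω₁ ∧ ClassK ω₂ ∧
    ∀ ξ μ, p.val (G ξ μ) ≤ ω₁ (p.val ξ) + ω₂ (q.val μ)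

/-- Input-to-state stability. -/
def IsISS (p : VectorNorm X) (q : VectorNorm U) (G : X → U → X) : Prop :=
  ∃ (β : ℝ≥0 → ℝ≥0 → ℝ≥0) (γ : ℝ≥0 → ℝ≥0), ClassKL β ∧ ClassK γ ∧
    ∀ (ξ : X) (u : ℕ → U), BoundedInput q u → ∀ k : ℕ,
      p.val (solution G ξ u k) ≤ β (p.val ξ) k + γ (supNorm q u)

/-- Proper and positive definite functions `W : X → ℝ₊`. -/
def ProperPosDef (p : VectorNorm X) (W : X → ℝ≥0) : Prop :=
  ∃ α₁ α₂ : ℝ≥0 → ℝ≥0, ClassKInf α₁ ∧ ClassKInf α₂ ∧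
    ∀ ξ, α₁ (p.val ξ) ≤ W ξ ∧ W ξ ≤ α₂ (p.val ξ)

/-- Dissipative finite-step ISS Lyapunov functions. The function `η` is `id - ρ`; this is written
as `ρ + η = id` because subtraction on `ℝ≥0` truncates. -/
def IsFiniteStepISSLyapunov (p : VectorNorm X) (q : VectorNorm U) (G : X → U → X)
    (V : X → ℝ≥0) : Prop :=
  ProperPosDef p V ∧
    ∃ (M : ℕ) (σ ρ η : ℝ≥0 → ℝ≥0), 1 ≤ M ∧ ClassK σ ∧ PosDefFun ρ ∧ ClassKInf η ∧
      (∀ s, ρ s + η s = s) ∧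
      ∀ (ξ : X) (u : ℕ → U), BoundedInput q u →
        V (solution G ξ u M) ≤ ρ (V ξ) + σ (supNorm q u)

end Systems

/-! ### Gain maps, small-gain condition, `Ω`-paths -/

section Gains

variable {N : ℕ}

/-- The gain map `Γ_⊕(s)_i = max_j γ_{ij}(s_j)`. -/
def gainMap (γ : Fin N → Fin N → ℝ≥0 → ℝ≥0) (s : Fin N → ℝ≥0) : Fin N → ℝ≥0 :=
  fun i => Finset.univ.sup fun j => γ i j (s j)

/-- The diagonal operator `diag(d_i)`. -/
def diagOp (d : Fin N → ℝ≥0 → ℝ≥0) (s : Fin N → ℝ≥0) : Fin N → ℝ≥0 :=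
  fun i => d i (s i)

/-- The small-gain condition `T ≱ id`: for no `s ≠ 0` is `T(s) ≥ s` componentwise. -/
def SmallGainCondition (T : (Fin N → ℝ≥0) → (Fin N → ℝ≥0)) : Prop :=
  ∀ s, s ≠ 0 → ¬ s ≤ T s

/-- The inverse of `σ ∈ 𝒦_∞` as a real function, for taking derivatives on `(0, ∞)`. -/
noncomputable def realInv (σ : ℝ≥0 → ℝ≥0) (t : ℝ) : ℝ :=
  ((Function.invFun σ t.toNNReal : ℝ≥0) : ℝ)

/-- `σ = (σ_1, …, σ_N) ∈ 𝒦_∞^N` is an `Ω`-path for `T`: each `σ_i⁻¹` is locally Lipschitz on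
`(0, ∞)`; on each compact subset of `(0, ∞)` the derivatives of the `σ_i⁻¹`, at their points of
differentiability, lie between two positive constants; and `T(σ(r)) < σ(r)` componentwise
for all `r > 0`. -/
structure IsOmegaPath (T : (Fin N → ℝ≥0) → (Fin N → ℝ≥0)) (σ : Fin N → ℝ≥0 → ℝ≥0) : Prop where
  classKInf : ∀ i, ClassKInf (σ i)
  locallyLipschitz : ∀ i, LocallyLipschitzOn (Set.Ioi 0) (Function.invFun (σ i))
  deriv_bounds : ∀ K : Set ℝ, IsCompact K → K ⊆ Set.Ioi 0 →
    ∃ c C : ℝ, 0 < c ∧ c < C ∧ ∀ i, ∀ r ∈ K,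
      DifferentiableAt ℝ (realInv (σ i)) r →
        c ≤ deriv (realInv (σ i)) r ∧ deriv (realInv (σ i)) r ≤ C
  decay : ∀ r, 0 < r → ∀ i, T (fun j => σ j r) i < σ i r

/-- The function `V(ξ) = max_i (σ_i⁻¹ ∘ d_i⁻¹)(V_i(ξ_i))`. -/
noncomputable def compositeV {n : Fin N → ℕ} (σ d : Fin N → ℝ≥0 → ℝ≥0)
    (V : ∀ i, (Fin (n i) → ℝ) → ℝ≥0) (ξ : ∀ i, Fin (n i) → ℝ) : ℝ≥0 :=
  Finset.univ.sup fun i => Function.invFun (σ i) (Function.invFun (d i) (V i (ξ i)))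

end Gains

end SmallGain

open SmallGain

namespace SmallGain

/-! ### Comparison functions -/

/-! The path is first built without regularity, by induction on the number of nodes
(`exists_decay_path`). For max-type gains, eliminating node `0` replaces `g i j` by the maximum of
`g i j` and the detour `g i 0 ∘ g 0 j`, and the small-gain condition survives. A path for the
smaller network leaves for the missing component the room between the gains into node `0` and the
inverses of the gains out of it.

Regularity is obtained on the inverses `τ j`, where decay reads `τ i (g i j s) < τ j s`.
Reparametrizing by the sum of all components gives inverses `id + μ j` with `μ j` increasing, so
slopes are at least `1`. Replacing `μ j` by a slightly smaller, locally Lipschitz average only helps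
the left side, and the loss on the right fits into the strict inequality (`exists_isOmegaPath`).

Along a path, `V ξ = r` means `V j (ξ j) ≤ d j (σ j r)`, so after `M` steps the gain part of `V i`
is at most `σ i r`, and `σ i⁻¹ ∘ d i⁻¹` turns this into `r - α i r`. An explicit `1 / (k + 1)`
estimate for the resulting scalar recursion (`decay_estimate`) and the `𝒦`-bounds on `G` between
multiples of `M` give ISS. -/

theorem ClassK.monotone {α : ℝ≥0 → ℝ≥0} (h : ClassK α) : Monotone α := h.2.1.monotone

theorem ClassK.pos {α : ℝ≥0 → ℝ≥0} (h : ClassK α) {s : ℝ≥0} (hs : 0 < s) : 0 < α s := by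
  simpa [h.2.2] using h.2.1 hs

theorem ClassK.comp {α β : ℝ≥0 → ℝ≥0} (h : ClassK α) (h' : ClassK β) :
    ClassK fun s => α (β s) :=
  ⟨h.1.comp h'.1, h.2.1.comp h'.2.1, by simp [h'.2.2, h.2.2]⟩

theorem ClassK.add {α β : ℝ≥0 → ℝ≥0} (h : ClassK α) (h' : ClassK β) :
    ClassK fun s => α s + β s :=
  ⟨h.1.add h'.1, h.2.1.add h'.2.1, by simp [h.2.2, h'.2.2]⟩

theorem ClassK.id : ClassK fun s => s := ⟨continuous_id, strictMono_id, rfl⟩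

theorem ClassK.const_mul {c : ℝ≥0} (hc : 0 < c) : ClassK fun s => c * s :=
  ⟨by fun_prop, fun _ _ h => mul_lt_mul_of_pos_left h hc, by simp⟩

/-- Substitute for subadditivity: the sum is at most twice the larger summand. -/
theorem ClassK.add_le {α : ℝ≥0 → ℝ≥0} (h : ClassK α) (s t : ℝ≥0) :
    α (s + t) ≤ α (2 * s) + α (2 * t) := by
  rcases le_total s t with hst | hst
  · exact (h.monotone (by rw [two_mul]; gcongr)).trans le_add_self
  · exact (h.monotone (by rw [two_mul]; gcongr)).trans le_self_add

theorem ClassKInf.id : ClassKInf fun s => s := ⟨ClassK.id, tendsto_id⟩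

theorem ClassKInf.comp {α β : ℝ≥0 → ℝ≥0} (h : ClassKInf α) (h' : ClassKInf β) :
    ClassKInf fun s => α (β s) :=
  ⟨h.1.comp h'.1, h.2.comp h'.2⟩

theorem ClassKInf.of_le {α β : ℝ≥0 → ℝ≥0} (h : ClassKInf α) (h' : ClassK β)
    (hle : ∀ s, α s ≤ β s) : ClassKInf β :=
  ⟨h', tendsto_atTop_mono hle h.2⟩

theorem ClassKInf.const_mul {c : ℝ≥0} (hc : 0 < c) : ClassKInf fun s => c * s :=
  ⟨ClassK.const_mul hc, Tendsto.const_mul_atTop hc tendsto_id⟩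

theorem ClassKInf.min {α β : ℝ≥0 → ℝ≥0} (h : ClassKInf α) (h' : ClassKInf β) :
    ClassKInf fun s => min (α s) (β s) := by
  refine ⟨⟨h.1.1.min h'.1.1, fun s t hst => ?_, by simp [h.1.2.2]⟩, tendsto_atTop.2 fun b => ?_⟩
  · exact lt_min ((min_le_left _ _).trans_lt (h.1.2.1 hst))
      ((min_le_right _ _).trans_lt (h'.1.2.1 hst))
  · filter_upwards [h.2.eventually_ge_atTop b, h'.2.eventually_ge_atTop b] with s h1 h2
    exact le_min h1 h2

theorem ClassKInf.max {α β : ℝ≥0 → ℝ≥0} (h : ClassKInf α) (h' : ClassKInf β) :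
    ClassKInf fun s => max (α s) (β s) := by
  refine h.of_le ⟨h.1.1.max h'.1.1, fun s t hst => ?_, by simp [h.1.2.2, h'.1.2.2]⟩
    fun _ => le_max_left _ _
  exact max_lt ((h.1.2.1 hst).trans_le (le_max_left _ _))
    ((h'.1.2.1 hst).trans_le (le_max_right _ _))

theorem ClassKInf.apply_invFun {α : ℝ≥0 → ℝ≥0} (h : ClassKInf α) (s : ℝ≥0) :
    α (Function.invFun α s) = s :=
  Function.rightInverse_invFun h.bijective.surjective s

theorem ClassKInf.invFun_apply {α : ℝ≥0 → ℝ≥0} (h : ClassKInf α) (s : ℝ≥0) :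
    Function.invFun α (α s) = s :=
  Function.leftInverse_invFun h.bijective.injective s

theorem ClassKInf.invFun {α : ℝ≥0 → ℝ≥0} (h : ClassKInf α) : ClassKInf (Function.invFun α) := by
  let e := h.1.2.1.orderIsoOfSurjective α h.bijective.surjective
  have he : Function.invFun α = e.symm := by
    funext s
    apply h.bijective.injective
    rw [h.apply_invFun]
    exact (e.apply_symm_apply s).symm
  rw [he]
  exact ⟨⟨e.symm.continuous, e.symm.strictMono, e.symm.map_bot⟩, e.symm.tendsto_atTop⟩

theorem ClassKInf.invFun_invFun {α : ℝ≥0 → ℝ≥0} (h : ClassKInf α) :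
    Function.invFun (Function.invFun α) = α := by
  funext s
  apply h.invFun.bijective.injective
  rw [h.invFun.apply_invFun, h.invFun_apply]

/-- The extra summand `s` keeps the sum strictly increasing even if every `α i` vanishes. -/
theorem ClassK.finset_sum {ι : Type*} {α : ι → ℝ≥0 → ℝ≥0} (h : ∀ i, ClassK (α i) ∨ α i = 0)
    (t : Finset ι) : ClassK fun s => s + ∑ i ∈ t, α i s := by
  classical
  induction t using Finset.induction_on with
  | empty => simpa using ClassK.id
  | insert a t ha ih =>
    simp_rw [Finset.sum_insert ha]
    rcases h a with h | h
    · simpa [add_left_comm] using h.add ih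
    · simpa [h] using ih

theorem ClassK.sum {ι : Type*} [Fintype ι] [Nonempty ι] {α : ι → ℝ≥0 → ℝ≥0}
    (h : ∀ i, ClassK (α i)) : ClassK fun s => ∑ i, α i s := by
  refine ⟨continuous_finsetSum _ fun i _ => (h i).1, fun s t hst => ?_, ?_⟩
  · exact Finset.sum_lt_sum_of_nonempty Finset.univ_nonempty fun i _ => (h i).2.1 hst
  · simp [fun i => (h i).2.2]

theorem exists_classKInf_le {ι : Type*} {α : ι → ℝ≥0 → ℝ≥0} (h : ∀ i, ClassKInf (α i))
    (t : Finset ι) : ∃ α' : ℝ≥0 → ℝ≥0, ClassKInf α' ∧ ∀ i ∈ t, ∀ s, α' s ≤ α i s := by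
  classical
  induction t using Finset.induction_on with
  | empty => exact ⟨_, ClassKInf.id, by simp⟩
  | insert a t ha ih =>
    obtain ⟨α', h', hle⟩ := ih
    refine ⟨_, (h a).min h', fun i hi s => ?_⟩
    rcases Finset.mem_insert.1 hi with rfl | hi
    · exact min_le_left _ _
    · exact (min_le_right _ _).trans (hle i hi s)

theorem exists_classKInf_ge {ι : Type*} {α : ι → ℝ≥0 → ℝ≥0} (h : ∀ i, ClassKInf (α i))
    (t : Finset ι) : ∃ α' : ℝ≥0 → ℝ≥0, ClassKInf α' ∧ ∀ i ∈ t, ∀ s, α i s ≤ α' s := by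
  classical
  induction t using Finset.induction_on with
  | empty => exact ⟨_, ClassKInf.id, by simp⟩
  | insert a t ha ih =>
    obtain ⟨α', h', hle⟩ := ih
    refine ⟨_, (h a).max h', fun i hi s => ?_⟩
    rcases Finset.mem_insert.1 hi with rfl | hi
    · exact le_max_left _ _
    · exact (hle i hi s).trans (le_max_right _ _)

/-- Finitely many functions `ρ_i` with `id - ρ_i ∈ 𝒦_∞` have a common upper bound of this kind. -/
theorem exists_decay_bound {ι : Type*} {ρ α : ι → ℝ≥0 → ℝ≥0} (hρ : ∀ i, Continuous (ρ i))
    (h : ∀ i, ClassKInf (α i)) (hs : ∀ i s, ρ i s + α i s = s) (t : Finset ι) :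
    ∃ ρ' η : ℝ≥0 → ℝ≥0, PosDefFun ρ' ∧ ClassKInf η ∧ (∀ s, ρ' s + η s = s) ∧
      ∀ i ∈ t, ∀ s, ρ i s ≤ ρ' s := by
  classical
  induction t using Finset.induction_on with
  | empty =>
    -- Starting from `s / 2` keeps the maximum positive definite, since the `ρ i` themselves may
    -- vanish.
    refine ⟨fun s => 2⁻¹ * s, fun s => 2⁻¹ * s, ⟨by fun_prop, by simp, fun s hs => by positivity⟩,
      ClassKInf.const_mul (by positivity), fun s => ?_, by simp⟩
    rw [← add_mul, ← two_mul, mul_inv_cancel₀ two_ne_zero, one_mul]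
  | insert a t ha ih =>
    obtain ⟨ρ', η, hρ', hη, hsum, hle⟩ := ih
    have ha0 : ρ a 0 = 0 := (add_eq_zero.1 (hs a 0)).1
    refine ⟨fun s => max (ρ a s) (ρ' s), fun s => min (α a s) (η s),
      ⟨(hρ a).max hρ'.1, by simp [ha0, hρ'.2.1], fun s hs =>
        (hρ'.2.2 s hs).trans_le (le_max_right _ _)⟩, (h a).min hη, fun s => ?_, ?_⟩
    -- Both pairs sum to `s`, so the larger `ρ` goes with the smaller complement.
    · have h1 := hs a s
      have h2 := hsum s
      rcases le_total (ρ a s) (ρ' s) with hle | hle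
      · have : η s ≤ α a s := by
          by_contra! hlt
          exact (add_lt_add_of_le_of_lt hle hlt).ne (h1.trans h2.symm)
        simp only [max_eq_right hle, min_eq_right this, h2]
      · have : α a s ≤ η s := by
          by_contra! hlt
          exact (add_lt_add_of_le_of_lt hle hlt).ne (h2.trans h1.symm)
        simp only [max_eq_left hle, min_eq_left this, h1]
    · intro i hi s
      rcases Finset.mem_insert.1 hi with rfl | hi
      · exact le_max_left _ _
      · exact (hle i hi s).trans (le_max_right _ _)

theorem ClassKL.of_div {F α : ℝ≥0 → ℝ≥0} (hF : ClassK F) (hα : ClassK α) :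
    ClassKL fun s t => F (α s / (t + 1)) := by
  refine ⟨fun t => ?_, fun s hs => ⟨?_, fun t t' h => hF.2.1 ?_, ?_⟩⟩
  · have := hF.comp ((ClassK.const_mul (c := (t + 1)⁻¹) (by positivity)).comp hα)
    simpa [div_eq_inv_mul] using this
  · exact hF.1.comp (continuous_const.div (by fun_prop) fun t => by positivity)
  · exact div_lt_div_of_pos_left (hα.pos hs) (by positivity) (by gcongr)
  · have h1 : Tendsto (fun t : ℝ≥0 => t + 1) atTop atTop :=
      tendsto_atTop_mono (fun _ => le_self_add) tendsto_id
    have h2 : Tendsto (fun t : ℝ≥0 => α s / (t + 1)) atTop (𝓝 0) := by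
      simpa [div_eq_mul_inv] using (tendsto_inv_atTop_zero.comp h1).const_mul (α s)
    have h3 := (hF.1.tendsto 0).comp h2
    rwa [hF.2.2] at h3

/-! ### Norms -/

section Norms

variable {E : Type*} [AddCommGroup E] [Module ℝ E]

theorem VectorNorm.val_zero (p : VectorNorm E) : p.val 0 = 0 :=
  NNReal.eq (map_zero p.toSeminorm)

theorem VectorNorm.val_add_le (p : VectorNorm E) (x y : E) : p.val (x + y) ≤ p.val x + p.val y :=
  NNReal.coe_le_coe.1 (map_add_le_add p.toSeminorm x y)

theorem VectorNorm.val_sum_le (p : VectorNorm E) {ι : Type*} (t : Finset ι) (x : ι → E) :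
    p.val (∑ i ∈ t, x i) ≤ ∑ i ∈ t, p.val (x i) :=
  Finset.le_sum_of_subadditive _ p.val_zero.le p.val_add_le t x

/-- In finite dimension every linear map is continuous for the norm `p`. Used for the projection
onto one factor, which an arbitrary norm need not contract. -/
theorem VectorNorm.exists_val_map_le [FiniteDimensional ℝ E] (p : VectorNorm E) (L : E →ₗ[ℝ] E) :
    ∃ C : ℝ≥0, 0 < C ∧ ∀ x, p.val (L x) ≤ C * p.val x := by
  let : NormedAddCommGroup E := AddGroupNorm.toNormedAddCommGroup
    { p.toSeminorm.toAddGroupSeminorm with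
      eq_zero_of_map_eq_zero' := p.eq_zero_of_map_eq_zero }
  let : NormedSpace ℝ E := ⟨fun a x => (p.toSeminorm.smul' a x).le⟩
  let L' : E →L[ℝ] E := LinearMap.toContinuousLinearMap L
  refine ⟨‖L'‖₊ + 1, by positivity, fun x => ?_⟩
  have h : ‖L x‖₊ ≤ ‖L'‖₊ * ‖x‖₊ := L'.le_opNNNorm x
  exact h.trans (mul_le_mul_left (le_self_add) _)

theorem supNorm_tail {q : VectorNorm E} {u : ℕ → E} (hu : BoundedInput q u) (k : ℕ) :
    BoundedInput q (fun l => u (k + l)) ∧ supNorm q (fun l => u (k + l)) ≤ supNorm q u := by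
  refine ⟨hu.mono ?_, ciSup_le fun l => le_ciSup hu (k + l)⟩
  rintro _ ⟨l, rfl⟩
  exact ⟨k + l, rfl⟩

end Norms

theorem VectorNorm.val_le_sum_component {N : ℕ} {n : Fin N → ℕ}
    (p : VectorNorm (∀ i, Fin (n i) → ℝ)) (ξ : ∀ i, Fin (n i) → ℝ) :
    p.val ξ ≤ ∑ i, (p.component i).val (ξ i) := by
  have := p.val_sum_le Finset.univ fun i => (Pi.single i (ξ i) : ∀ i, Fin (n i) → ℝ)
  rwa [Finset.univ_sum_single] at this

theorem VectorNorm.exists_component_le {N : ℕ} {n : Fin N → ℕ}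
    (p : VectorNorm (∀ i, Fin (n i) → ℝ)) (i : Fin N) :
    ∃ C : ℝ≥0, 0 < C ∧ ∀ ξ : ∀ i, Fin (n i) → ℝ, (p.component i).val (ξ i) ≤ C * p.val ξ :=
  p.exists_val_map_le (LinearMap.single ℝ (fun i => Fin (n i) → ℝ) i ∘ₗ LinearMap.proj i)

/-! ### Finite-step Lyapunov functions imply input-to-state stability -/

theorem solution_add {X U : Type*} (G : X → U → X) (ξ : X) (u : ℕ → U) (k l : ℕ) :
    solution G ξ u (k + l) = solution G (solution G ξ u k) (fun i => u (k + i)) l := by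
  induction l with
  | zero => rfl
  | succ l ih => rw [← add_assoc, solution, ih]; rfl

/-- Solutions of the scalar inequality `v(k+1) ≤ v(k) - η(v(k)) + w`. -/
theorem decay_estimate {ρ η : ℝ≥0 → ℝ≥0} (hη : ClassKInf η) (hs : ∀ s, ρ s + η s = s) {w : ℝ≥0}
    {v : ℕ → ℝ≥0} (hv : ∀ k, v (k + 1) ≤ ρ (v k) + w) (k : ℕ) :
    v k ≤ Function.invFun η (2 * (v 0 / (k + 1))) + (Function.invFun η (2 * w) + w) := by
  -- The level `b` is never left once reached: either `w ≤ η (v k)` and `v` does not increase, or `v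
  -- k ≤ η⁻¹(2w)` and one step adds at most `w`. No monotonicity of `ρ` enters.
  set b := Function.invFun η (2 * w) + w with hb
  have hdich : ∀ k, v k ≤ b → v (k + 1) ≤ b := by
    intro k hk
    rcases le_total w (η (v k)) with h | h
    · refine (hv k).trans (le_trans ?_ hk)
      calc ρ (v k) + w ≤ ρ (v k) + η (v k) := by gcongr
        _ = v k := hs _
    · refine (hv k).trans ?_
      refine add_le_add ?_ le_rfl
      refine (le_self_add.trans_eq (hs _)).trans ?_
      rw [← hη.invFun_apply (v k)]
      exact hη.invFun.1.monotone (h.trans (by rw [two_mul]; exact le_self_add))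
  -- Above `b` the input uses up at most half of the decrease `η (v k)`.
  have hstep : ∀ k, b < v k → v (k + 1) + η (v k) / 2 ≤ v k := by
    intro k hk
    have h : 2 * w ≤ η (v k) := by
      rw [← hη.apply_invFun (2 * w)]
      exact hη.1.monotone (le_self_add.trans hk.le)
    have h' : w ≤ η (v k) / 2 := by
      rw [le_div_iff₀ two_pos, mul_comm]; exact h
    calc v (k + 1) + η (v k) / 2 ≤ ρ (v k) + η (v k) / 2 + η (v k) / 2 := by
          gcongr; exact (hv k).trans (by gcongr)
      _ = v k := by rw [add_assoc, add_halves, hs]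
  -- While `v` stays above `b` it decreases, so each earlier decrement is at least `η (v k) / 2`;
  -- summing them gives `η (v k) ≤ 2 v 0 / (k + 1)`.
  have key : ∀ k, v k ≤ b ∨ v (k + 1) + (k + 1) * (η (v k) / 2) ≤ v 0 := by
    intro k
    induction k with
    | zero =>
      rcases le_or_gt (v 0) b with h | h
      · exact Or.inl h
      · exact Or.inr (by simpa using hstep 0 h)
    | succ k ih =>
      rcases le_or_gt (v (k + 1)) b with h | h
      · exact Or.inl h
      · have hk : b < v k := by
          by_contra! h'
          exact (hdich k h').not_gt h
        have ih := ih.resolve_left hk.not_ge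
        refine Or.inr ?_
        have hmono : η (v (k + 1)) ≤ η (v k) :=
          hη.1.monotone (le_self_add.trans (hstep k hk))
        calc v (k + 1 + 1) + ((k + 1 : ℕ) + 1) * (η (v (k + 1)) / 2)
            = v (k + 1 + 1) + η (v (k + 1)) / 2 + (k + 1) * (η (v (k + 1)) / 2) := by
              push_cast; ring
          _ ≤ v (k + 1) + (k + 1) * (η (v k) / 2) := by
              gcongr; exact hstep _ h
          _ ≤ v 0 := ih
  rcases key k with h | h
  · exact h.trans le_add_self
  · refine le_trans ?_ le_self_add
    rw [← hη.invFun_apply (v k)]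
    refine hη.invFun.1.monotone ?_
    rw [← mul_div_assoc, le_div_iff₀ (by positivity)]
    calc η (v k) * (k + 1) = 2 * ((k + 1) * (η (v k) / 2)) := by field_simp
      _ ≤ 2 * v 0 := by gcongr; exact le_add_self.trans h

section Systems

variable {X U : Type*} [AddCommGroup X] [Module ℝ X] [AddCommGroup U] [Module ℝ U]

/-- Controls the trajectory between multiples of the step length, where the Lyapunov inequality says
nothing. -/
theorem GloballyKBounded.solution_le {p : VectorNorm X} {q : VectorNorm U} {G : X → U → X}
    (h : GloballyKBounded p q G) (k : ℕ) :
    ∃ ω₁ ω₂ : ℝ≥0 → ℝ≥0, ClassK ω₁ ∧ ClassK ω₂ ∧ ∀ l ≤ k, ∀ ξ u, BoundedInput q u →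
      p.val (solution G ξ u l) ≤ ω₁ (p.val ξ) + ω₂ (supNorm q u) := by
  obtain ⟨κ₁, κ₂, h₁, h₂, hG⟩ := h
  induction k with
  | zero =>
    refine ⟨_, _, ClassK.id, ClassK.id, fun l hl ξ u _ => ?_⟩
    rw [Nat.le_zero.1 hl]
    exact le_self_add
  | succ k ih =>
    obtain ⟨ω₁, ω₂, h₁', h₂', ih⟩ := ih
    have two : (0 : ℝ≥0) < 2 := two_pos
    refine ⟨_, _, h₁'.add (h₁.comp ((ClassK.const_mul two).comp h₁')),
      h₂'.add ((h₁.comp ((ClassK.const_mul two).comp h₂')).add h₂), fun l hl ξ u hu => ?_⟩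
    rcases Nat.le_succ_iff.1 hl with hl | rfl
    · exact (ih l hl ξ u hu).trans (add_le_add le_self_add le_self_add)
    · calc p.val (solution G ξ u (k + 1))
          ≤ κ₁ (p.val (solution G ξ u k)) + κ₂ (q.val (u k)) := hG _ _
        _ ≤ κ₁ (2 * ω₁ (p.val ξ)) + κ₁ (2 * ω₂ (supNorm q u)) + κ₂ (supNorm q u) := by
          refine add_le_add ((h₁.monotone (ih k le_rfl ξ u hu)).trans (h₁.add_le _ _)) ?_
          exact h₂.monotone (le_ciSup hu k)
        _ ≤ _ := by
          rw [add_assoc]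
          exact add_le_add le_add_self le_add_self

theorem IsFiniteStepISSLyapunov.isISS {p : VectorNorm X} {q : VectorNorm U} {G : X → U → X}
    {V : X → ℝ≥0} (h : IsFiniteStepISSLyapunov p q G V) (hG : GloballyKBounded p q G) :
    IsISS p q G := by
  obtain ⟨⟨α₁, α₂, hα₁, hα₂, hV⟩, M, σ, ρ, η, hM, hσ, -, hη, hsum, hstep⟩ := h
  obtain ⟨ω₁, ω₂, hω₁, hω₂, hω⟩ := hG.solution_le M
  have two : (0 : ℝ≥0) < 2 := two_pos
  have hM' : (0 : ℝ≥0) < M := by exact_mod_cast hM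
  have m2 := ClassK.const_mul two
  have hi := hη.invFun.1.comp m2
  have hb := hi.add ClassK.id
  have hO := hω₁.comp (m2.comp (hα₁.invFun.1.comp m2))
  refine ⟨_, _, ClassKL.of_div (hO.comp hi) ((ClassK.const_mul hM').comp hα₂.1),
    (hO.comp (hb.comp hσ)).add hω₂, fun ξ u hu k => ?_⟩
  obtain ⟨j, l, hl, rfl⟩ : ∃ j l, l < M ∧ k = j * M + l :=
    ⟨k / M, k % M, Nat.mod_lt _ hM, (Nat.div_add_mod' k M).symm⟩
  have hv : ∀ i, V (solution G ξ u ((i + 1) * M)) ≤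
      ρ (V (solution G ξ u (i * M))) + σ (supNorm q u) := by
    intro i
    obtain ⟨hu', hle⟩ := supNorm_tail hu (i * M)
    rw [add_mul, one_mul, solution_add]
    exact (hstep _ _ hu').trans (add_le_add le_rfl (hσ.monotone hle))
  have hj := decay_estimate (v := fun i => V (solution G ξ u (i * M))) hη hsum hv j
  simp only [zero_mul, solution] at hj
  set w := σ (supNorm q u)
  set β := Function.invFun η (2 * (M * α₂ (p.val ξ) / ((j * M + l : ℕ) + 1))) with hβ
  -- Since `l < M`, `k + 1 ≤ M (j + 1)`; this is the origin of the factor `M` in the `𝒦ℒ` function.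
  have hdiv : V ξ / (j + 1) ≤ M * α₂ (p.val ξ) / ((j * M + l : ℕ) + 1) := by
    rw [div_le_div_iff₀ (by positivity) (by positivity)]
    have h1 : (((j * M + l : ℕ) + 1 : ℕ) : ℝ≥0) ≤ (M * (j + 1) : ℕ) := by
      exact_mod_cast (by nlinarith : j * M + l + 1 ≤ M * (j + 1))
    push_cast at h1 ⊢
    calc V ξ * (j * M + l + 1) ≤ α₂ (p.val ξ) * (M * (j + 1)) := by
          gcongr; exact (hV ξ).2
      _ = _ := by ring
  have hj' : p.val (solution G ξ u (j * M)) ≤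
      Function.invFun α₁ (2 * β) + Function.invFun α₁ (2 * (Function.invFun η (2 * w) + w)) := by
    rw [← hα₁.invFun_apply (p.val _)]
    refine (hα₁.invFun.1.monotone ((hV _).1.trans (hj.trans (add_le_add_left ?_ _)))).trans
      (hα₁.invFun.1.add_le _ _)
    exact hη.invFun.1.monotone (by gcongr)
  obtain ⟨hu', hle⟩ := supNorm_tail hu (j * M)
  rw [solution_add]
  calc _ ≤ ω₁ (p.val (solution G ξ u (j * M))) + ω₂ (supNorm q u) :=
        (hω l hl.le _ _ hu').trans (add_le_add le_rfl (hω₂.monotone hle))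
    _ ≤ _ := by
        rw [← add_assoc]
        exact add_le_add ((hω₁.monotone hj').trans (hω₁.add_le _ _)) le_rfl

end Systems

/-! ### The composite Lyapunov function -/

theorem gainMap_le {N : ℕ} {γ : Fin N → Fin N → ℝ≥0 → ℝ≥0} {s : Fin N → ℝ≥0} {i : Fin N}
    {a : ℝ≥0} : gainMap γ s i ≤ a ↔ ∀ j, γ i j (s j) ≤ a := by
  simp [gainMap]

theorem properPosDef_compositeV {N : ℕ} {n : Fin N → ℕ} {p : VectorNorm (∀ i, Fin (n i) → ℝ)}
    {V : ∀ i, (Fin (n i) → ℝ) → ℝ≥0} (hV : ∀ i, ProperPosDef (p.component i) (V i))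
    {σ d : Fin N → ℝ≥0 → ℝ≥0} (hσ : ∀ i, ClassKInf (σ i)) (hd : ∀ i, ClassKInf (d i)) :
    ProperPosDef p (compositeV σ d V) := by
  choose α₁ α₂ hα₁ hα₂ hV using hV
  choose C hC hpC using p.exists_component_le
  have ha : ∀ i, ClassKInf fun s => Function.invFun (σ i) (Function.invFun (d i) s) :=
    fun i => (hσ i).invFun.comp (hd i).invFun
  obtain ⟨β₁, hβ₁, hle₁⟩ := exists_classKInf_le (fun i => (ha i).comp (hα₁ i)) Finset.univ
  obtain ⟨β₂, hβ₂, hle₂⟩ := exists_classKInf_ge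
    (fun i => (ha i).comp ((hα₂ i).comp (ClassKInf.const_mul (hC i)))) Finset.univ
  -- The lower bound comes from `‖ξ‖ ≤ N β₁⁻¹(V ξ)`; `N + 1` instead of `N` keeps the factor
  -- invertible for `N = 0`.
  refine ⟨_, β₂, hβ₁.comp (ClassKInf.const_mul (c := (N + 1 : ℝ≥0)⁻¹) (by positivity)), hβ₂,
    fun ξ => ⟨?_, Finset.sup_le fun i hi => ?_⟩⟩
  · have h : p.val ξ ≤ N * Function.invFun β₁ (compositeV σ d V ξ) := by
      refine (p.val_le_sum_component ξ).trans ((Finset.sum_le_card_nsmul _ _ _ ?_).trans_eq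
        (by rw [Finset.card_univ, Fintype.card_fin, nsmul_eq_mul]))
      intro i hi
      rw [← hβ₁.invFun_apply ((p.component i).val _)]
      refine hβ₁.invFun.1.monotone ((hle₁ i hi _).trans (le_trans ?_
        (Finset.le_sup (f := fun i => Function.invFun (σ i) (Function.invFun (d i) (V i (ξ i))))
          hi)))
      exact (ha i).1.monotone (hV i _).1
    rw [← hβ₁.apply_invFun (compositeV σ d V ξ)]
    refine hβ₁.1.monotone ?_
    rw [inv_mul_le_iff₀ (by positivity)]
    exact h.trans (mul_le_mul_left le_self_add _)
  · refine le_trans ((ha i).1.monotone ((hV i _).2.trans ?_)) (hle₂ i hi _)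
    exact (hα₂ i).1.monotone (hpC i ξ)

theorem isFiniteStepISSLyapunov_compositeV {N m : ℕ} {n : Fin N → ℕ}
    {p : VectorNorm (∀ i, Fin (n i) → ℝ)} {q : VectorNorm (Fin m → ℝ)}
    {G : (∀ i, Fin (n i) → ℝ) → (Fin m → ℝ) → (∀ i, Fin (n i) → ℝ)} {M : ℕ} (hM : 1 ≤ M)
    {V : ∀ i, (Fin (n i) → ℝ) → ℝ≥0} {γ : Fin N → Fin N → ℝ≥0 → ℝ≥0}
    (hγ : ∀ i j, ClassKInf (γ i j) ∨ γ i j = 0)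
    {γu : Fin N → ℝ≥0 → ℝ≥0} (hγu : ∀ i, ClassK (γu i) ∨ γu i = 0)
    {σ d : Fin N → ℝ≥0 → ℝ≥0} (hd : ∀ i, ClassKInf (d i)) (hσ : ∀ i, ClassKInf (σ i))
    (hV : ∀ i, ProperPosDef (p.component i) (V i))
    (hstep : ∀ ξ (u : ℕ → Fin m → ℝ), BoundedInput q u → ∀ i, V i (solution G ξ u M i) ≤
      max (gainMap γ (fun j => V j (ξ j)) i) (γu i (supNorm q u)))
    (hdecay : ∀ r, 0 < r → ∀ i, (gainMap γ ∘ diagOp d) (fun j => σ j r) i ≤ σ i r)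
    (hα : ∀ i, ∃ α : ℝ≥0 → ℝ≥0, ClassKInf α ∧
      ∀ s, Function.invFun (σ i) (Function.invFun (d i) (σ i s)) + α s = s) :
    IsFiniteStepISSLyapunov p q G (compositeV σ d V) := by
  choose α hα hsum using hα
  have ha : ∀ i, ClassKInf fun s => Function.invFun (σ i) (Function.invFun (d i) s) :=
    fun i => (hσ i).invFun.comp (hd i).invFun
  obtain ⟨ρ, η, hρ, hη, hρη, hle⟩ :=
    exists_decay_bound (fun i => ((ha i).comp (hσ i)).1.1) hα hsum Finset.univ
  have hmono : ∀ i j, Monotone (γ i j) := fun i j => by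
    rcases hγ i j with h | h
    · exact h.1.monotone
    · rw [h]; exact monotone_const
  have hγ0 : ∀ i j, γ i j 0 = 0 := fun i j => by
    rcases hγ i j with h | h
    · exact h.1.2.2
    · rw [h]; rfl
  have hu : ∀ i, ClassK (fun s => Function.invFun (σ i) (Function.invFun (d i) (γu i s))) ∨
      (fun s => Function.invFun (σ i) (Function.invFun (d i) (γu i s))) = 0 := fun i => by
    rcases hγu i with h | h
    · exact Or.inl ((ha i).1.comp h)
    · right
      funext s
      simp [h, (ha i).1.2.2]
  refine ⟨properPosDef_compositeV hV hσ hd, M, _, ρ, η, hM, ClassK.finset_sum hu Finset.univ,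
    hρ, hη, hρη, fun ξ u hbu => Finset.sup_le fun i hi => ?_⟩
  set r := compositeV σ d V ξ with hr
  have hVr : ∀ j, V j (ξ j) ≤ d j (σ j r) := fun j => by
    have h : Function.invFun (σ j) (Function.invFun (d j) (V j (ξ j))) ≤ r :=
      Finset.le_sup (f := fun i => Function.invFun (σ i) (Function.invFun (d i) (V i (ξ i))))
        (Finset.mem_univ j)
    have := (hd j).1.monotone ((hσ j).1.monotone h)
    rwa [(hσ j).apply_invFun, (hd j).apply_invFun] at this
  have hgain : gainMap γ (fun j => V j (ξ j)) i ≤ σ i r := by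
    refine gainMap_le.2 fun j => (hmono i j (hVr j)).trans ?_
    rcases eq_or_ne r 0 with h0 | h0
    · simp [h0, (hσ _).1.2.2, (hd _).1.2.2, hγ0]
    · exact gainMap_le.1 (hdecay r (pos_iff_ne_zero.2 h0) i) j
  refine ((ha i).1.monotone ((hstep ξ u hbu i).trans (max_le_max_right _ hgain))).trans ?_
  rw [(ha i).1.monotone.map_max]
  refine max_le ((hle i hi r).trans le_self_add) ?_
  refine le_trans ?_ (le_add_self.trans le_add_self)
  exact Finset.single_le_sum
    (f := fun i => Function.invFun (σ i) (Function.invFun (d i) (γu i (supNorm q u))))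
    (fun _ _ => zero_le) hi

/-! ### Paths of strict decay -/

/-- The midpoint of `L` and the minimum of the `U i` works; the latter supplies strict growth and
unboundedness where `L` is only monotone. -/
theorem exists_classKInf_between {ι : Type*} {L : ℝ≥0 → ℝ≥0} (hL : Continuous L) (hLm : Monotone L)
    (hL0 : L 0 = 0) {U : ι → ℝ≥0 → ℝ≥0} (hU : ∀ i, ClassKInf (U i))
    (hLU : ∀ i, ∀ r, 0 < r → L r < U i r) (t : Finset ι) :
    ∃ α : ℝ≥0 → ℝ≥0, ClassKInf α ∧ ∀ r, 0 < r → L r < α r ∧ ∀ i ∈ t, α r < U i r := by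
  classical
  have mid : ∀ V : ℝ≥0 → ℝ≥0, ClassKInf V → (∀ r, 0 < r → L r < V r) →
      ∃ α : ℝ≥0 → ℝ≥0, ClassKInf α ∧ ∀ r, 0 < r → L r < α r ∧ α r < V r := by
    intro V hV hlt
    have hh : (0 : ℝ≥0) < 2⁻¹ := by positivity
    refine ⟨fun r => 2⁻¹ * (V r + L r), (ClassKInf.const_mul hh).comp (hV.of_le
      ⟨hV.1.1.add hL, hV.1.2.1.add_monotone hLm, by simp [hV.1.2.2, hL0]⟩ fun _ => le_self_add),
      fun r hr => ?_⟩
    have := NNReal.coe_lt_coe.2 (hlt r hr)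
    constructor <;> rw [← NNReal.coe_lt_coe] <;> push_cast <;> linarith
  suffices h : ∃ V : ℝ≥0 → ℝ≥0, ClassKInf V ∧ (∀ r, 0 < r → L r < V r) ∧
      ∀ i ∈ t, ∀ r, V r ≤ U i r by
    obtain ⟨V, hV, hlt, hle⟩ := h
    obtain ⟨α, hα, h⟩ := mid V hV hlt
    exact ⟨α, hα, fun r hr => ⟨(h r hr).1, fun i hi => (h r hr).2.trans_le (hle i hi r)⟩⟩
  induction t using Finset.induction_on with
  | empty =>
    refine ⟨fun r => r + L r, ClassKInf.id.of_le ⟨continuous_id.add hL,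
      strictMono_id.add_monotone hLm, by simp [hL0]⟩ fun _ => le_self_add, fun r hr => ?_, by simp⟩
    exact lt_add_of_pos_left _ hr
  | insert a t ha ih =>
    obtain ⟨V, hV, hlt, hle⟩ := ih
    refine ⟨_, (hU a).min hV, fun r hr => lt_min (hLU a r hr) (hlt r hr), fun i hi r => ?_⟩
    rcases Finset.mem_insert.1 hi with rfl | hi
    · exact min_le_left _ _
    · exact (min_le_right _ _).trans (hle i hi r)

/-- The gains obtained by eliminating the first node of the network. -/
def eliminate {N : ℕ} (g : Fin (N + 1) → Fin (N + 1) → ℝ≥0 → ℝ≥0) (i j : Fin N) (s : ℝ≥0) : ℝ≥0 :=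
  max (g i.succ j.succ s) (g i.succ 0 (g 0 j.succ s))

/-- A vector `s ≤ Γ'(s)` of the reduced network extends to a counterexample of the full one: give
node `0` exactly the value it receives from the others, so that each detour becomes a direct gain
from node `0`. -/
theorem SmallGainCondition.eliminate {N : ℕ} {g : Fin (N + 1) → Fin (N + 1) → ℝ≥0 → ℝ≥0}
    (hm : ∀ i j, Monotone (g i j)) (h : SmallGainCondition (gainMap g)) :
    SmallGainCondition (gainMap (eliminate g)) := by
  intro s hs hle
  have hsup : ∀ S i j, g i j (S j) ≤ gainMap g S i := fun S i j => gainMap_le.1 le_rfl j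
  let S : Fin (N + 1) → ℝ≥0 := Fin.cons (Finset.univ.sup fun j : Fin N => g 0 j.succ (s j)) s
  refine h S (fun h0 => hs ?_) fun i => ?_
  · funext i
    exact congrFun h0 i.succ
  · refine Fin.cases ?_ (fun i => ?_) i
    · change (Finset.univ.sup fun j : Fin N => g 0 j.succ (s j)) ≤ _
      exact Finset.sup_le fun j _ => hsup S 0 j.succ
    · refine (hle i).trans (gainMap_le.2 fun j => max_le (hsup S i.succ j.succ) ?_)
      exact (hm _ _ (Finset.le_sup (f := fun j : Fin N => g 0 j.succ (s j))
        (Finset.mem_univ j))).trans (hsup S i.succ 0)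

theorem exists_decay_path {N : ℕ} {g : Fin N → Fin N → ℝ≥0 → ℝ≥0}
    (hg : ∀ i j, ClassKInf (g i j) ∨ g i j = 0) (h : SmallGainCondition (gainMap g)) :
    ∃ σ : Fin N → ℝ≥0 → ℝ≥0, (∀ i, ClassKInf (σ i)) ∧
      ∀ r, 0 < r → ∀ i j, g i j (σ j r) < σ i r := by
  induction N with
  | zero => exact ⟨fun i => i.elim0, fun i => i.elim0, fun _ _ i => i.elim0⟩
  | succ N ih =>
    have hm : ∀ i j, Monotone (g i j) := fun i j => by
      rcases hg i j with h | h
      · exact h.1.monotone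
      · rw [h]; exact monotone_const
    have hc : ∀ i j, Continuous (g i j) := fun i j => by
      rcases hg i j with h | h
      · exact h.1.1
      · rw [h]; exact continuous_const
    have h0 : ∀ i j, g i j 0 = 0 := fun i j => by
      rcases hg i j with h | h
      · exact h.1.2.2
      · rw [h]; rfl
    have hg' : ∀ i j, ClassKInf (eliminate g i j) ∨ eliminate g i j = 0 := by
      intro i j
      have h2 : ClassKInf (fun s => g i.succ 0 (g 0 j.succ s)) ∨
          (fun s => g i.succ 0 (g 0 j.succ s)) = 0 := by
        rcases hg i.succ 0 with h1 | h1
        · rcases hg 0 j.succ with h2 | h2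
          · exact Or.inl (h1.comp h2)
          · right; funext s; simp [h2, h0]
        · right; funext s; simp [h1]
      rcases hg i.succ j.succ with h1 | h1
      · rcases h2 with h2 | h2
        · exact Or.inl (h1.max h2)
        · left
          convert h1 using 1
          funext s
          simpa [eliminate] using (congrFun h2 s).trans_le zero_le
      · rcases h2 with h2 | h2
        · left
          convert h2 using 1
          funext s
          simp [eliminate, h1]
        · right
          funext s
          have := congrFun h2 s
          simp_all [eliminate]
    obtain ⟨σ, hσ, hdec⟩ := ih hg' (h.eliminate hm)
    let L : ℝ≥0 → ℝ≥0 := fun r => Finset.univ.sup fun j => g 0 j.succ (σ j r)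
    have hL : Continuous L := Continuous.finset_sup_apply fun j _ => (hc _ _).comp (hσ j).1.1
    have hLm : Monotone L := fun r r' hr =>
      Finset.sup_mono_fun fun j _ => hm _ _ ((hσ j).1.monotone hr)
    have hL0 : L 0 = 0 := by simp [L, (hσ _).1.2.2, h0]
    -- The cap on the new component is `(g i 0)⁻¹ ∘ σ i`, and it lies above `L` because the reduced
    -- gains contain the detours through node `0`. A zero gain imposes no cap, so `id + L` serves.
    have hU : ∀ i : Fin N, ∃ U : ℝ≥0 → ℝ≥0, ClassKInf U ∧ (∀ r, 0 < r → L r < U r) ∧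
        ∀ r s, 0 < r → s < U r → g i.succ 0 s < σ i r := by
      intro i
      rcases hg i.succ 0 with h1 | h1
      · refine ⟨_, h1.invFun.comp (hσ i), fun r hr => ?_, fun r s _ hs => ?_⟩
        · refine (Finset.sup_lt_iff ?_).2 fun j _ => ?_
          · exact h1.invFun.1.pos ((hσ i).1.pos hr)
          · rw [← h1.invFun_apply (g 0 j.succ (σ j r))]
            exact h1.invFun.1.2.1 ((le_max_right _ _).trans_lt (hdec r hr i j))
        · simpa only [h1.apply_invFun] using h1.1.2.1 hs
      · refine ⟨fun r => r + L r, ClassKInf.id.of_le ⟨continuous_id.add hL,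
          strictMono_id.add_monotone hLm, by simp [hL0]⟩ fun _ => le_self_add,
          fun r hr => lt_add_of_pos_left _ hr, fun r s hr _ => ?_⟩
        simpa [h1] using (hσ i).1.pos hr
    choose U hU hLU hUσ using hU
    obtain ⟨α, hα, hLα⟩ := exists_classKInf_between hL hLm hL0 hU hLU Finset.univ
    refine ⟨Fin.cons α σ, fun i => ?_, fun r hr i j => ?_⟩
    · refine Fin.cases ?_ (fun i => ?_) i
      · exact hα
      · exact hσ i
    -- The self-gain of node `0` was not used in the elimination; the small-gain condition on
    -- vectors supported at node `0` bounds it.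
    · have h00 : g 0 0 (α r) < α r := by
        by_contra! hle
        refine h (Pi.single 0 (α r)) ?_ ?_
        · simpa using (hα.1.pos hr).ne'
        · intro i
          rcases eq_or_ne i 0 with rfl | hi
          · rw [Pi.single_eq_same]
            refine hle.trans ?_
            have := gainMap_le.1 (le_refl (gainMap g (Pi.single 0 (α r)) 0)) 0
            rwa [Pi.single_eq_same] at this
          · rw [Pi.single_eq_of_ne hi]
            exact zero_le
      refine Fin.cases ?_ (fun i => ?_) i <;> refine Fin.cases ?_ (fun j => ?_) j
      · exact h00
      · exact (Finset.le_sup (f := fun j : Fin N => g 0 j.succ (σ j r)) (Finset.mem_univ j)).trans_lt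
          (hLα r hr).1
      · exact hUσ i r _ hr ((hLα r hr).2 i (Finset.mem_univ i))
      · exact (le_max_left _ _).trans_lt (hdec r hr i j)

/-! ### Regularization -/

/-- A continuous monotone function is bounded from below, as closely as desired on `(0, ∞)`, by a
monotone function that is locally Lipschitz there, namely by its averages over `[s - e(s), s]`. -/
theorem exists_locallyLipschitz_minorant {κ : ℝ → ℝ} (hκ : Continuous κ) (hm : Monotone κ)
    {O : Set (ℝ × ℝ)} (hO : IsOpen O) (hdiag : ∀ s, 0 < s → (s, s) ∈ O) (h0 : (0, 0) ∉ O) :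
    ∃ κ' : ℝ → ℝ, Continuous κ' ∧ Monotone κ' ∧ (∀ s, κ' s ≤ κ s) ∧ κ' 0 = κ 0 ∧
      (∀ s, 0 < s → ∃ t, (s, t) ∈ O ∧ κ t ≤ κ' s) ∧
      ∀ s, 0 < s → ∃ C : ℝ≥0, ∃ u ∈ 𝓝 s, LipschitzOnWith C κ' u := by
  have hne : (Oᶜ).Nonempty := ⟨_, h0⟩
  -- Halving the distance keeps `(s, s - e s)` in `O`. In the maximum metric `e` has Lipschitz
  -- constant `1 / 2`, so `s - e s * l` is nondecreasing in `s` for `l ∈ [0, 1]`, and the average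
  -- inherits monotonicity.
  let e : ℝ → ℝ := fun s => Metric.infDist (s, s) Oᶜ / 2
  have he0 : ∀ s, 0 ≤ e s := fun s => div_nonneg Metric.infDist_nonneg two_pos.le
  have hepos : ∀ s, 0 < s → 0 < e s := fun s hs => half_pos
    ((hO.isClosed_compl.notMem_iff_infDist_pos hne).1 (not_not.2 (hdiag s hs)))
  have heO : ∀ s, 0 < s → (s, s - e s) ∈ O := by
    intro s hs
    by_contra hmem
    have h1 : Metric.infDist (s, s) Oᶜ ≤ dist (s, s) (s, s - e s) :=
      Metric.infDist_le_dist_of_mem hmem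
    rw [Prod.dist_eq, dist_self, Real.dist_eq, sub_sub_cancel, abs_of_nonneg (he0 s),
      max_eq_right (he0 s)] at h1
    have := hepos s hs
    simp only [e] at h1 this
    linarith
  have hdist : ∀ s t : ℝ, dist (s, s) (t, t) = |s - t| := fun s t => by
    rw [Prod.dist_eq, max_self, Real.dist_eq]
  have helip : ∀ s t, e s ≤ e t + |s - t| / 2 := by
    intro s t
    have := Metric.infDist_le_infDist_add_dist (s := Oᶜ) (x := (s, s)) (y := (t, t))
    rw [hdist] at this
    simp only [e]
    linarith
  have heL : LipschitzWith 1 e := LipschitzWith.of_le_add fun s t => by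
    rw [Real.dist_eq]
    linarith [helip s t, abs_nonneg (s - t)]
  have he00 : e 0 = 0 := by
    simp only [e, Metric.infDist_zero_of_mem (show ((0 : ℝ), (0 : ℝ)) ∈ Oᶜ from h0), zero_div]
  have hint : ∀ s, IntervalIntegrable (fun l => κ (s - e s * l)) MeasureTheory.volume 0 1 :=
    fun s => (by fun_prop : Continuous fun l => κ (s - e s * l)).intervalIntegrable _ _
  have hle : ∀ s, ∫ l in (0 : ℝ)..1, κ (s - e s * l) ≤ κ s := by
    intro s
    have := intervalIntegral.integral_mono_on zero_le_one (hint s)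
      (intervalIntegrable_const (c := κ s)) fun l hl => hm (sub_le_self s (mul_nonneg (he0 s) hl.1))
    simpa using this
  have hge : ∀ s, κ (s - e s) ≤ ∫ l in (0 : ℝ)..1, κ (s - e s * l) := by
    intro s
    have := intervalIntegral.integral_mono_on zero_le_one
      (intervalIntegrable_const (c := κ (s - e s))) (hint s) fun l hl =>
        hm (sub_le_sub_left (mul_le_of_le_one_right (he0 s) hl.2) s)
    simpa using this
  refine ⟨fun s => ∫ l in (0 : ℝ)..1, κ (s - e s * l), ?_, ?_, hle, ?_, ?_, ?_⟩
  · have := heL.continuous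
    exact intervalIntegral.continuous_parametric_intervalIntegral_of_continuous' (by fun_prop) 0 1
  · intro s t hst
    refine intervalIntegral.integral_mono_on zero_le_one (hint s) (hint t) fun l hl => hm ?_
    have h1 := helip t s
    rw [abs_of_nonneg (sub_nonneg.2 hst)] at h1
    nlinarith [hl.1, hl.2, mul_le_mul_of_nonneg_right h1 hl.1]
  · simp [he00]
  · exact fun s hs => ⟨s - e s, heO s hs, hge s⟩
  · intro s hs
    -- By substitution the average is a difference quotient of a primitive of `κ`, which is `C¹` in
    -- `(s, e)` where `e ≠ 0`; Lipschitz continuity of `e` then suffices.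
    let P : ℝ → ℝ := fun x => ∫ y in (0 : ℝ)..x, κ y
    have hP : ContDiff ℝ 1 P := by
      have hd : ∀ x, HasDerivAt P (κ x) x := fun x => hκ.integral_hasStrictDerivAt 0 x |>.hasDerivAt
      refine contDiff_one_iff_deriv.2 ⟨fun x => (hd x).differentiableAt, ?_⟩
      rwa [show deriv P = κ from funext fun x => (hd x).deriv]
    let F : ℝ × ℝ → ℝ := fun x => (P x.1 - P (x.1 - x.2)) / x.2
    have hF : ContDiffAt ℝ 1 F (s, e s) := by
      refine ContDiffAt.div ?_ contDiffAt_snd (hepos s hs).ne'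
      exact ((hP.comp contDiff_fst).sub (hP.comp (contDiff_fst.sub contDiff_snd))).contDiffAt
    obtain ⟨C, u, hu, hC⟩ := hF.exists_lipschitzOnWith
    have hse : LipschitzWith (max 1 1) fun s => (s, e s) := LipschitzWith.id.prodMk heL
    refine ⟨C * max 1 1, (fun s => (s, e s)) ⁻¹' u ∩ Set.Ioi 0,
      inter_mem (hse.continuous.continuousAt hu) (Ioi_mem_nhds hs), ?_⟩
    have heq : ∀ x, 0 < x → ∫ l in (0 : ℝ)..1, κ (x - e x * l) = F (x, e x) := by
      intro x hx
      simp only [F, P]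
      rw [eq_div_iff (hepos x hx).ne', mul_comm, intervalIntegral.mul_integral_comp_sub_mul,
        intervalIntegral.integral_interval_sub_left (hκ.intervalIntegrable _ _)
          (hκ.intervalIntegrable _ _)]
      simp
    intro x hx y hy
    simp only [heq x hx.2, heq y hy.2]
    exact (hC.comp hse.lipschitzOnWith fun _ hx => hx) hx.1 hy.1

/-! ### `Ω`-paths -/

/-- Functions `τ_i = id + κ_i` with `κ_i` monotone and locally Lipschitz on `(0, ∞)` are the
inverses of the components of an `Ω`-path if they decrease strictly along all gains. -/
theorem isOmegaPath_invFun {N : ℕ} {g : Fin N → Fin N → ℝ≥0 → ℝ≥0} {κ : Fin N → ℝ → ℝ}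
    {τ : Fin N → ℝ≥0 → ℝ≥0} (hτ : ∀ i, ClassKInf (τ i))
    (hτκ : ∀ i, ∀ s : ℝ≥0, (τ i s : ℝ) = s + κ i s) (hm : ∀ i, Monotone (κ i))
    (hlip : ∀ i s, 0 < s → ∃ C : ℝ≥0, ∃ u ∈ 𝓝 s, LipschitzOnWith C (κ i) u)
    (hdec : ∀ s, 0 < s → ∀ i j, τ i (g i j s) < τ j s) :
    IsOmegaPath (gainMap g) fun i => Function.invFun (τ i) where
  classKInf i := (hτ i).invFun
  locallyLipschitz i := by
    rw [(hτ i).invFun_invFun]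
    intro x hx
    obtain ⟨C, u, hu, hC⟩ := hlip i x hx
    refine ⟨1 + C, (fun y : ℝ≥0 => (y : ℝ)) ⁻¹' u,
      mem_nhdsWithin_of_mem_nhds (NNReal.continuous_coe.continuousAt hu), ?_⟩
    refine LipschitzOnWith.of_dist_le_mul fun y hy z hz => ?_
    rw [NNReal.dist_eq, hτκ, hτκ, NNReal.dist_eq]
    have h := hC.dist_le_mul _ hy _ hz
    rw [Real.dist_eq, Real.dist_eq] at h
    calc |(y : ℝ) + κ i y - (z + κ i z)| = |((y : ℝ) - z) + (κ i y - κ i z)| := by ring_nf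
      _ ≤ |(y : ℝ) - z| + |κ i y - κ i z| := abs_add_le _ _
      _ ≤ |(y : ℝ) - z| + C * |(y : ℝ) - z| := by gcongr
      _ = _ := by push_cast; ring
  deriv_bounds K hK hK0 := by
    have hbd : ∃ C : ℝ, ∀ i, ∀ r ∈ K, deriv (κ i) r ≤ C := by
      refine hK.induction_on (p := fun S => ∃ C : ℝ, ∀ i, ∀ r ∈ S, deriv (κ i) r ≤ C)
        ⟨0, by simp⟩ (fun s t hst ⟨C, hC⟩ => ⟨C, fun i r hr => hC i r (hst hr)⟩) ?_ ?_
      · rintro s t ⟨C, hC⟩ ⟨C', hC'⟩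
        refine ⟨max C C', fun i r hr => ?_⟩
        rcases hr with hr | hr
        · exact (hC i r hr).trans (le_max_left _ _)
        · exact (hC' i r hr).trans (le_max_right _ _)
      · intro x hx
        choose C u hu hC using fun i => hlip i x (hK0 hx)
        refine ⟨{y | ∀ i, u i ∈ 𝓝 y}, mem_nhdsWithin_of_mem_nhds
          (eventually_all.2 fun i => eventually_mem_nhds_iff.2 (hu i)), ∑ i, (C i : ℝ),
          fun i r hr => ?_⟩
        refine ((le_abs_self _).trans (norm_deriv_le_of_lipschitzOn (hr i) (hC i))).trans ?_
        exact Finset.single_le_sum (f := fun i => (C i : ℝ)) (fun _ _ => NNReal.coe_nonneg _)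
          (Finset.mem_univ i)
    obtain ⟨C, hC⟩ := hbd
    -- The summand `id` gives slope at least `1`, as `κ i` is monotone; the final `+ 1` makes the
    -- two bounds distinct.
    refine ⟨1, max 1 C + 1, one_pos, by linarith [le_max_left 1 C], fun i r hr hdiff => ?_⟩
    have heq : realInv (fun s => Function.invFun (τ i) s) =ᶠ[𝓝 r] fun s => s + κ i s := by
      filter_upwards [Ioi_mem_nhds (hK0 hr)] with s hs
      have hs' : (s.toNNReal : ℝ) = s := Real.coe_toNNReal s (le_of_lt hs)
      change ((Function.invFun (Function.invFun (τ i)) s.toNNReal : ℝ≥0) : ℝ) = _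
      rw [(hτ i).invFun_invFun, hτκ, hs']
    have hd : DifferentiableAt ℝ (κ i) r := by
      simpa using (heq.differentiableAt_iff.1 hdiff).sub differentiableAt_id
    have hder : deriv (realInv fun s => Function.invFun (τ i) s) r = 1 + deriv (κ i) r := by
      rw [heq.deriv_eq, deriv_fun_add differentiableAt_fun_id hd, deriv_id'']
    have h0 : 0 ≤ deriv (κ i) r := (hm i).deriv_nonneg
    constructor
    · exact hder.symm ▸ (by linarith)
    · exact hder.symm ▸ (by linarith [hC i r hr, le_max_right 1 C])
  decay r hr i := by
    have hpos : ∀ i, 0 < Function.invFun (τ i) r := fun i => (hτ i).invFun.1.pos hr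
    refine (Finset.sup_lt_iff (hpos i)).2 fun j _ => (hτ i).1.2.1.lt_iff_lt.1 ?_
    have := hdec _ (hpos j) i j
    rw [(hτ j).apply_invFun] at this
    rw [(hτ i).apply_invFun]
    exact this

/-- The small-gain condition for a maximum-type gain operator yields an `Ω`-path. -/
theorem exists_isOmegaPath {N : ℕ} {g : Fin N → Fin N → ℝ≥0 → ℝ≥0}
    (hg : ∀ i j, ClassKInf (g i j) ∨ g i j = 0) (h : SmallGainCondition (gainMap g)) :
    ∃ σ : Fin N → ℝ≥0 → ℝ≥0, IsOmegaPath (gainMap g) σ := by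
  obtain ⟨σ, hσ, hdec⟩ := exists_decay_path hg h
  rcases isEmpty_or_nonempty (Fin N) with hN | hN
  · exact ⟨σ, fun i => isEmptyElim i, fun i => isEmptyElim i,
      fun K _ _ => ⟨1, 2, one_pos, one_lt_two, fun i => isEmptyElim i⟩,
      fun _ _ i => isEmptyElim i⟩
  have hgc : ∀ i j, Continuous (g i j) := fun i j => by
    rcases hg i j with h | h
    · exact h.1.1
    · rw [h]; exact continuous_const
  have hg0 : ∀ i j, g i j 0 = 0 := fun i j => by
    rcases hg i j with h | h
    · exact h.1.2.2
    · rw [h]; rfl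
  -- The components `σ j ∘ S⁻¹`, with `S` the sum of the path's components, trace the same path;
  -- their inverses are `ν j = S ∘ σ j⁻¹ = id + μ j`.
  have hS : ClassK fun r => ∑ k, σ k r := ClassK.sum fun k => (hσ k).1
  let ν : Fin N → ℝ≥0 → ℝ≥0 := fun j s => ∑ k, σ k (Function.invFun (σ j) s)
  have hν : ∀ j, ClassK (ν j) := fun j => hS.comp (hσ j).invFun.1
  let μ : Fin N → ℝ≥0 → ℝ≥0 := fun j s =>
    ∑ k ∈ Finset.univ.erase j, σ k (Function.invFun (σ j) s)
  have hνμ : ∀ j s, ν j s = s + μ j s := fun j s => by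
    simp only [ν, μ]
    rw [← Finset.add_sum_erase _ _ (Finset.mem_univ j), (hσ j).apply_invFun]
  have hνdec : ∀ s, 0 < s → ∀ i j, ν i (g i j s) < ν j s := by
    intro s hs i j
    refine hS.2.1 ?_
    have := hdec _ ((hσ j).invFun.1.pos hs) i j
    rw [(hσ j).apply_invFun] at this
    simpa only [(hσ i).invFun_apply] using (hσ i).invFun.1.2.1 this
  have hμc : ∀ j, Continuous (μ j) := fun j =>
    continuous_finsetSum _ fun k _ => (hσ k).1.1.comp (hσ j).invFun.1.1
  have hμm : ∀ j, Monotone (μ j) := fun j s t hst =>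
    Finset.sum_le_sum fun k _ => (hσ k).1.monotone ((hσ j).invFun.1.monotone hst)
  have hμ0 : ∀ j, μ j 0 = 0 := fun j => by
    simp [μ, (hσ _).1.2.2, (hσ j).invFun.1.2.2]
  let κ : Fin N → ℝ → ℝ := fun j s => μ j s.toNNReal
  have hκc : ∀ j, Continuous (κ j) := fun j =>
    NNReal.continuous_coe.comp ((hμc j).comp continuous_real_toNNReal)
  have hκm : ∀ j, Monotone (κ j) := fun j s t hst =>
    NNReal.coe_le_coe.2 (hμm j (Real.toNNReal_le_toNNReal hst))
  -- `(s, t) ∈ O j` says that all decay inequalities out of node `j` at `s` survive lowering `μ j s`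
  -- to `μ j t`.
  let O : Fin N → Set (ℝ × ℝ) := fun j =>
    {x | 0 < x.1} ∩ ⋂ i, {x | (ν i (g i j x.1.toNNReal) : ℝ) < x.1 + κ j x.2}
  have hO : ∀ j, IsOpen (O j) := by
    intro j
    refine (isOpen_lt continuous_const continuous_fst).inter
      (isOpen_iInter_of_finite fun i => isOpen_lt ?_ ?_)
    · exact NNReal.continuous_coe.comp ((hν i).1.comp ((hgc i j).comp
        (continuous_real_toNNReal.comp continuous_fst)))
    · exact continuous_fst.add ((hκc j).comp continuous_snd)
  have hdiag : ∀ j s, 0 < s → (s, s) ∈ O j := by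
    refine fun j s hs => ⟨hs, Set.mem_iInter.2 fun i => ?_⟩
    rw [Set.mem_ofPred_eq]
    have := NNReal.coe_lt_coe.2 (hνdec _ (Real.toNNReal_pos.2 hs) i j)
    rwa [hνμ j, NNReal.coe_add, Real.coe_toNNReal s hs.le] at this
  choose κ' hc hm hle hzero hge hlip using fun j =>
    exists_locallyLipschitz_minorant (hκc j) (hκm j) (hO j) (hdiag j) fun h => lt_irrefl (0 : ℝ) h.1
  have hκ0 : ∀ j, κ' j 0 = 0 := fun j => by
    rw [hzero]
    simp [κ, hμ0]
  have hnn : ∀ j (s : ℝ≥0), 0 ≤ κ' j s := fun j s => (hκ0 j).symm.trans_le (hm j s.2)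
  let τ : Fin N → ℝ≥0 → ℝ≥0 := fun j s => s + (κ' j s).toNNReal
  have hτκ : ∀ j (s : ℝ≥0), (τ j s : ℝ) = s + κ' j s := fun j s => by
    simp only [τ, NNReal.coe_add, Real.coe_toNNReal _ (hnn j s)]
  have hτ : ∀ j, ClassKInf (τ j) := by
    refine fun j => ClassKInf.id.of_le ⟨?_, ?_, ?_⟩ fun s => le_self_add
    · have := hc j
      fun_prop
    · exact strictMono_id.add_monotone fun s t hst =>
        Real.toNNReal_le_toNNReal (hm j (NNReal.coe_le_coe.2 hst))
    · simp [τ, hκ0]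
  refine ⟨_, isOmegaPath_invFun hτ hτκ hm hlip fun s hs i j => ?_⟩
  rw [← NNReal.coe_lt_coe]
  obtain ⟨t, ⟨-, ht⟩, hts⟩ := hge j s hs
  have h1 := Set.mem_iInter.1 ht i
  rw [Set.mem_ofPred_eq, Real.toNNReal_coe] at h1
  calc (τ i (g i j s) : ℝ) ≤ ν i (g i j s) := by
        rw [hτκ, hνμ, NNReal.coe_add]
        have := hle i (g i j s)
        simp only [κ, Real.toNNReal_coe] at this
        gcongr
    _ < s + κ j t := h1
    _ ≤ s + κ' j s := by gcongr
    _ = τ j s := (hτκ j s).symm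

end SmallGain

theorem mainTheorem1 {N m : ℕ} {n : Fin N → ℕ}
    (p : VectorNorm (∀ i, Fin (n i) → ℝ)) (q : VectorNorm (Fin m → ℝ))
    (g : ∀ i, (∀ j, Fin (n j) → ℝ) → (Fin m → ℝ) → (Fin (n i) → ℝ))
    (hG : GloballyKBounded p q (overall g))
    (M : ℕ) (hM : 1 ≤ M)
    (V : ∀ i, (Fin (n i) → ℝ) → ℝ≥0)
    (γ : Fin N → Fin N → ℝ≥0 → ℝ≥0) (hγ : ∀ i j, ClassKInf (γ i j) ∨ γ i j = 0)
    (γu : Fin N → ℝ≥0 → ℝ≥0) (hγu : ∀ i, ClassK (γu i) ∨ γu i = 0)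
    (δ d : Fin N → ℝ≥0 → ℝ≥0) (hδ : ∀ i, PosDefFun (δ i))
    (hdδ : ∀ i s, d i s = s + δ i s) (hd : ∀ i, ClassKInf (d i))
    (hV : ∀ i, ProperPosDef (p.component i) (V i))
    (hstep : ∀ (ξ : ∀ i, Fin (n i) → ℝ) (u : ℕ → Fin m → ℝ), BoundedInput q u → ∀ i,
      V i (solution (overall g) ξ u M i) ≤
        max (gainMap γ (fun j => V j (ξ j)) i) (γu i (supNorm q u)))
    (hsgc : SmallGainCondition (gainMap γ ∘ diagOp d)) :
    (∃ σ : Fin N → ℝ≥0 → ℝ≥0, IsOmegaPath (gainMap γ ∘ diagOp d) σ) ∧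
    ∀ σ : Fin N → ℝ≥0 → ℝ≥0, IsOmegaPath (gainMap γ ∘ diagOp d) σ →
      (∀ i, ∃ α : ℝ≥0 → ℝ≥0, ClassKInf α ∧
        ∀ s, Function.invFun (σ i) (Function.invFun (d i) (σ i s)) + α s = s) →
      IsFiniteStepISSLyapunov p q (overall g) (compositeV σ d V) ∧
      IsISS p q (overall g) := by
  -- `gainMap γ ∘ diagOp d` is itself the gain map of the functions `γ i j ∘ d j`.
  have hg : ∀ i j, ClassKInf (fun s => γ i j (d j s)) ∨ (fun s => γ i j (d j s)) = 0 := by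
    intro i j
    rcases hγ i j with h | h
    · exact Or.inl (h.comp (hd j))
    · exact Or.inr (by simp only [h]; rfl)
  refine ⟨exists_isOmegaPath hg hsgc, fun σ hσ hα => ?_⟩
  have hL := isFiniteStepISSLyapunov_compositeV hM hγ hγu hd hσ.classKInf hV hstep
    (fun r hr i => (hσ.decay r hr i).le) hα
  exact ⟨hL, hL.isISS hG⟩
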